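/- Let $\mathbb F$ be an algebraically closed field of characteristic $p>0$ with $p\neq 2$, let $n\ge 2$, and let $GL_n=GL_n(\mathbb F)$. Identify $\mathbb Z^n$ with the character group of the torus of diagonal matrices, $\mu=(\mu_1,\dots,\mu_n)$ corresponding to $\operatorname{diag}(t_1,\dots,t_n)\mapsto t_1^{\mu_1}\cdots t_n^{\mu_n}$, and write $M_\mu$ for the $\mu$-weight space of a rational $GL_n$-module $M$. Let $\lambda\in\mathbb Z^n$ satisfy $\lambda_1\ge\dots\ge\lambda_n$ and $\lambda_{n-1}=\lambda_n=0$, and let $L=L_n(\lambda)$ be the simple rational $GL_n$-module of highest weight $\lambda$. Let $E_{n-1,n}$ be the operator on $L$ given by the corresponding element of the hyperalgebra, that is, $E_{n-1,n}v$ is the coefficient of $c$ in the polynomial expression $c\mapsto(1+c\,y_{n-1,n})v$, where $y_{n-1,n}$ is the matrix unit with entry $1$ in position $(n-1,n)$. Put $$L^{(1,1)}=\bigoplus_{\nu_{n-1}=\lambda_{n-1}+1,\ \nu_n=\lambda_n+1}L_\nu,\qquad L^{(1,1)\times}=\{v\in L^{(1,1)}\mid E_{n-1,n}v=0\},$$ where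 $L^{(1,1)\times}$ is regarded as a module for $GL_{n-2}$, embedded in $GL_n$ as the upper left block. Let $\mu$ be a weight of $L$ (that is, $L_\mu\neq0$) with $L_\mu\subseteq L^{(1,1)}$, let $\overline{\overline{\mu}}=(\mu_1,\dots,\mu_{n-2})$, and let $\omega=(\mu_1,\dots,\mu_{n-2},2,0)$. Then $$\dim\bigl((L^{(1,1)\times})_{\overline{\overline{\mu}}}\bigr)=\dim L_\mu-\dim L_\omega .$$ Moreover, $E_{n-1,n}$ maps $L_\mu$ onto $L_\omega$. -/

import Mathlib

open Matrix

namespace GLRep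

noncomputable section

/-- The diagonal matrix `diag(t₁, …, tₙ)` as an element of `GLₙ(F)`; these elements form the
maximal torus `T(n)`. -/
def torus {n : ℕ} {F : Type*} [Field F] (t : Fin n → Fˣ) : GL (Fin n) F :=
  Units.map (Matrix.diagonalRingHom (Fin n) F).toMonoidHom (MulEquiv.piUnits.symm t)

/-- The value at `diag(t₁, …, tₙ)` of the character `μ = (μ₁, …, μₙ) ∈ ℤⁿ = X(n)`, that is
`t₁ ^ μ₁ ⋯ tₙ ^ μₙ`. -/
def character {n : ℕ} {F : Type*} [Field F] (μ : Fin n → ℤ) (t : Fin n → Fˣ) : Fˣ :=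
  ∏ i, t i ^ μ i

/-- The element `u(c) = 1 + c y_{ij}` (`i ≠ j`) of the root subgroup of `GLₙ(F)` for the root
`ε_i - ε_j`. -/
def rootElement {n : ℕ} {F : Type*} [Field F] {i j : Fin n} (hij : i ≠ j) (c : F) :
    GL (Fin n) F :=
  Matrix.SpecialLinearGroup.toGL (Matrix.SpecialLinearGroup.transvection hij c)

/-- A function on `GLₙ(F)` is regular if it is given by a polynomial in the matrix entries
divided by a power of the determinant. -/
def IsRegular {n : ℕ} {F : Type*} [Field F] (f : GL (Fin n) F → F) : Prop :=
  ∃ (P : MvPolynomial (Fin n × Fin n) F) (k : ℕ), ∀ g : GL (Fin n) F,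
    f g * (g : Matrix (Fin n) (Fin n) F).det ^ k =
      MvPolynomial.eval (fun ab => (g : Matrix (Fin n) (Fin n) F) ab.1 ab.2) P

section Representations

variable {n : ℕ} {F : Type*} [Field F] {V : Type*} [AddCommGroup V] [Module F V]

/-- The weight space `V_μ` of a representation of `GLₙ(F)`: the vectors on which the torus of
diagonal matrices acts through the character `μ`. -/
def weightSpace (ρ : Representation F (GL (Fin n) F) V) (μ : Fin n → ℤ) : Submodule F V :=
  ⨅ t : Fin n → Fˣ, LinearMap.ker (ρ (torus t) - ((character μ t : Fˣ) : F) • LinearMap.id)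

theorem mem_weightSpace (ρ : Representation F (GL (Fin n) F) V) (μ : Fin n → ℤ) (v : V) :
    v ∈ weightSpace ρ μ ↔ ∀ t, ρ (torus t) v = ((character μ t : Fˣ) : F) • v := by
  simp [weightSpace, sub_eq_zero]

/-- `ρ` is a rational representation: it is finite-dimensional and all its matrix coefficients
are regular functions on `GLₙ(F)`. -/
structure IsRational (ρ : Representation F (GL (Fin n) F) V) : Prop where
  finiteDimensional : FiniteDimensional F V
  regular : ∀ (φ : Module.Dual F V) (v : V), IsRegular fun g => φ (ρ g v)

/-- `e` is the expansion of `c ↦ ρ (1 + c y_{ij})` in powers of `c`: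
`ρ (1 + c y_{ij}) = ∑ r, c ^ r • e r` for all `c`. -/
def IsExpansion (ρ : Representation F (GL (Fin n) F) V) {i j : Fin n} (hij : i ≠ j)
    (e : ℕ →₀ Module.End F V) : Prop :=
  ∀ c : F, ρ (rootElement hij c) = e.sum fun r T => c ^ r • T

open Classical in
/-- The action on a rational representation of the element `y_{ij}^{(r)} ⊗ 1` of the hyperalgebra
of `GLₙ(F)` (`i ≠ j`), written `E_{ij}^{(r)}` for `i < j` and `F_{ji}^{(r)}` for `i > j`: it is the
coefficient of `c ^ r` in `ρ (1 + c y_{ij})`. For a rational representation over an infinite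
field the expansion exists and is unique (see below); otherwise the value `0` may be taken. -/
def dividedPower (ρ : Representation F (GL (Fin n) F) V) {i j : Fin n} (hij : i ≠ j) (r : ℕ) :
    Module.End F V :=
  if h : ∃ e, IsExpansion ρ hij e then h.choose r else 0

theorem exists_isExpansion (ρ : Representation F (GL (Fin n) F) V) (h : IsRational ρ)
    {i j : Fin n} (hij : i ≠ j) : ∃ e, IsExpansion ρ hij e := by
  classical
  have := h.finiteDimensional
  let b := Module.finBasis F V
  have key : ∀ x y, ∃ q : Polynomial F, ∀ c,
      b.coord x (ρ (rootElement hij c) (b y)) = q.eval c := by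
    intro x y
    obtain ⟨P, k, hP⟩ := h.regular (b.coord x) (b y)
    refine ⟨MvPolynomial.aeval (fun ab : Fin n × Fin n =>
      Polynomial.C ((1 : Matrix (Fin n) (Fin n) F) ab.1 ab.2) +
        Polynomial.C (Matrix.single i j (1 : F) ab.1 ab.2) * Polynomial.X) P, fun c => ?_⟩
    have hc := hP (rootElement hij c)
    have hdet : ((rootElement hij c : GL (Fin n) F) : Matrix (Fin n) (Fin n) F).det = 1 :=
      (Matrix.SpecialLinearGroup.transvection hij c).2
    rw [hdet, one_pow, mul_one] at hc
    refine hc.trans ?_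
    rw [← Polynomial.coe_evalRingHom, MvPolynomial.aeval_def, MvPolynomial.hom_eval₂,
      ← MvPolynomial.eval₂_id]
    congr 1
    · ext a; simp
    · funext ab
      have hab : ((rootElement hij c : GL (Fin n) F) : Matrix (Fin n) (Fin n) F) =
        1 + Matrix.single i j c := rfl
      rw [hab]
      by_cases h : i = ab.1 ∧ j = ab.2
      · simp [h]
      · simp [h]
  choose q hq using key
  let N := (Finset.univ.sup fun xy : Fin _ × Fin _ => (q xy.1 xy.2).natDegree) + 1
  have hN : ∀ x y, (q x y).natDegree < N := fun x y =>
    Nat.lt_succ_of_le (Finset.le_sup (f := fun xy : Fin _ × Fin _ => (q xy.1 xy.2).natDegree)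
      (Finset.mem_univ (x, y)))
  refine ⟨Finsupp.onFinset (Finset.range N)
    (fun r => Matrix.toLin b b (Matrix.of fun x y => (q x y).coeff r)) ?_, fun c => ?_⟩
  · intro r hr
    by_contra hr'
    apply hr
    have : (Matrix.of fun x y => (q x y).coeff r) = 0 := by
      ext x y
      simp only [Finset.mem_range, not_lt] at hr'
      simpa using Polynomial.coeff_eq_zero_of_natDegree_lt ((hN x y).trans_le hr')
    rw [this, map_zero]
  · rw [Finsupp.onFinset_sum _ (by simp)]
    refine b.ext fun y => b.ext_elem fun x => ?_
    have h1 := hq x y c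
    rw [Polynomial.eval_eq_sum_range' (hN x y)] at h1
    rw [← b.coord_apply, h1]
    simp [Matrix.toLin_self, Finsupp.single_apply, mul_comm]

theorem isExpansion_unique [Infinite F] (ρ : Representation F (GL (Fin n) F) V)
    {i j : Fin n} (hij : i ≠ j) {e e' : ℕ →₀ Module.End F V}
    (he : IsExpansion ρ hij e) (he' : IsExpansion ρ hij e') : e = e' := by
  classical
  ext r v
  refine sub_eq_zero.1 ((Module.forall_dual_apply_eq_zero_iff F _).1 ?_)
  intro φ
  have hP : ∀ f : ℕ →₀ Module.End F V, IsExpansion ρ hij f → ∀ c,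
      φ (ρ (rootElement hij c) v) =
        (∑ s ∈ f.support, Polynomial.monomial s (φ (f s v))).eval c := by
    intro f hf c
    rw [hf c]
    simp [Finsupp.sum, Polynomial.eval_finsetSum, mul_comm]
  have hc : ∀ f : ℕ →₀ Module.End F V,
      (∑ s ∈ f.support, Polynomial.monomial s (φ (f s v))).coeff r = φ (f r v) := by
    intro f
    simp only [Polynomial.finsetSum_coeff, Polynomial.coeff_monomial]
    rw [Finset.sum_ite_eq' f.support r]
    by_cases h : f r = 0
    · simp [h]
    · simp [h]
  have := Polynomial.funext (fun c => (hP e he c).symm.trans (hP e' he' c))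
  rw [map_sub, ← hc e, ← hc e', this, sub_self]

theorem dividedPower_eq [Infinite F] (ρ : Representation F (GL (Fin n) F) V)
    {i j : Fin n} (hij : i ≠ j) {e : ℕ →₀ Module.End F V} (he : IsExpansion ρ hij e) (r : ℕ) :
    dividedPower ρ hij r = e r := by
  have h : ∃ e, IsExpansion ρ hij e := ⟨e, he⟩
  rw [dividedPower, dif_pos h, isExpansion_unique ρ hij h.choose_spec he]

end Representations

/-- The simple root `α_i = ε_i - ε_{i+1}`. -/
def simpleRoot {k : ℕ} (i : Fin k) : Fin (k + 1) → ℤ :=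
  Pi.single i.castSucc 1 - Pi.single i.succ 1

/-- The dominance order: `μ ≤ ν` if and only if `ν - μ` is a sum of simple roots. -/
def Subdominant {k : ℕ} (μ ν : Fin (k + 1) → ℤ) : Prop :=
  ∃ a : Fin k → ℕ, ν - μ = ∑ i, (a i : ℤ) • simpleRoot i

/-- `ρ` is (a copy of) the simple module `Lₙ(ν)`, `n = k + 1`: the irreducible rational
representation of `GLₙ(F)` with highest weight `ν`. -/
structure IsSimpleOfHighestWeight {k : ℕ} {F : Type*} [Field F] {V : Type*} [AddCommGroup V]
    [Module F V] (ρ : Representation F (GL (Fin (k + 1)) F) V) (ν : Fin (k + 1) → ℤ) : Prop where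
  rational : IsRational ρ
  irreducible : ρ.IsIrreducible
  isWeight : weightSpace ρ ν ≠ ⊥
  highest : ∀ μ, weightSpace ρ μ ≠ ⊥ → Subdominant μ ν

/-! From here on the group is `GLₙ` with `n = m + 2`. -/

/-- The index `n` (the last one). -/
def idxN (m : ℕ) : Fin (m + 2) := Fin.last (m + 1)

/-- The index `n - 1` (the last but one). -/
def idxN1 (m : ℕ) : Fin (m + 2) := (Fin.last m).castSucc

theorem idxN1_ne_idxN (m : ℕ) : idxN1 m ≠ idxN m := (Fin.castSucc_lt_last (Fin.last m)).ne

/-- The `(n-2)`-tuple obtained from `μ` by dropping the last two entries. -/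
def dropTwo {m : ℕ} (μ : Fin (m + 2) → ℤ) : Fin m → ℤ := fun i => μ (Fin.castAdd 2 i)

/-- The weight `(μ₁, …, μ_{n-2}, 2, 0)`. -/
def omegaWeight {m : ℕ} (μ : Fin (m + 2) → ℤ) : Fin (m + 2) → ℤ :=
  Function.update (Function.update μ (idxN1 m) 2) (idxN m) 0

/-- The embedding `GL_{n-2} → GLₙ`, `A ↦ diag(A, 1, 1)`, as the upper left block. -/
def levi (m : ℕ) (F : Type*) [Field F] : GL (Fin m) F →* GL (Fin (m + 2)) F :=
  Units.map
    { toFun := fun A => Matrix.reindex finSumFinEquiv finSumFinEquiv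
        (Matrix.fromBlocks A 0 0 (1 : Matrix (Fin 2) (Fin 2) F))
      map_one' := by simp
      map_mul' := fun A B => by
        simp [Matrix.reindex_apply, Matrix.submatrix_mul_equiv, Matrix.fromBlocks_multiply] }

section Levels

variable {m : ℕ} {F : Type*} [Field F] {V : Type*} [AddCommGroup V] [Module F V]

/-- The `(i,j)`-level: the sum of the weight spaces `V_μ` over the weights `μ` with
`μ_{n-1} = ν_{n-1} + i` and `μ_n = ν_n + j`. -/
def level (ρ : Representation F (GL (Fin (m + 2)) F) V) (ν : Fin (m + 2) → ℤ) (i j : ℤ) :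
    Submodule F V :=
  ⨆ (μ : Fin (m + 2) → ℤ) (_ : μ (idxN1 m) = ν (idxN1 m) + i ∧ μ (idxN m) = ν (idxN m) + j),
    weightSpace ρ μ

/-- The operator `E_{n-1,n}`. -/
def raising (ρ : Representation F (GL (Fin (m + 2)) F) V) : Module.End F V :=
  dividedPower ρ (idxN1_ne_idxN m) 1

/-- The subspace of the `(i,j)`-level consisting of the vectors killed by `E_{n-1,n}`. -/
def levelTimes (ρ : Representation F (GL (Fin (m + 2)) F) V) (ν : Fin (m + 2) → ℤ) (i j : ℤ) :
    Submodule F V :=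
  level ρ ν i j ⊓ LinearMap.ker (raising ρ)

/-- The `χ`-weight space, for the torus of `GL_{n-2} ⊆ GLₙ`, of a (`GL_{n-2}`-stable) subspace `W`:
the vectors of `W` that have weight `χ` for the restriction of `ρ` to `GL_{n-2}`. -/
def leviWeightSpace (ρ : Representation F (GL (Fin (m + 2)) F) V) (W : Submodule F V)
    (χ : Fin m → ℤ) : Submodule F V :=
  W ⊓ weightSpace (ρ.comp (levi m F)) χ

end Levels

end

end GLRep

namespace GLRep

section

variable {n : ℕ} {F : Type*} [Field F]

theorem character_mul (μ : Fin n → ℤ) (s t : Fin n → Fˣ) :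
    character μ (s * t) = character μ s * character μ t := by
  simp [character, mul_zpow, Finset.prod_mul_distrib]

theorem character_add (μ ν : Fin n → ℤ) (t : Fin n → Fˣ) :
    character (μ + ν) t = character μ t * character ν t := by
  simp [character, _root_.zpow_add, Finset.prod_mul_distrib]

theorem character_mulSingle (μ : Fin n → ℤ) (i : Fin n) (u : Fˣ) :
    character μ (Pi.mulSingle i u) = u ^ μ i := by
  rw [character, Finset.prod_eq_single i]
  · simp
  · intro k _ hk
    simp [Pi.mulSingle_eq_of_ne hk]
  · simp

theorem character_single (i : Fin n) (r : ℤ) (t : Fin n → Fˣ) :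
    character (Pi.single i r) t = t i ^ r := by
  rw [character, Finset.prod_eq_single i]
  · simp
  · intro k _ hk
    simp [Pi.single_eq_of_ne hk]
  · simp

theorem coe_torus (t : Fin n → Fˣ) :
    (torus t : Matrix (Fin n) (Fin n) F) = Matrix.diagonal fun i => (t i : F) := rfl

theorem torus_mul (s t : Fin n → Fˣ) : (torus (s * t) : GL (Fin n) F) = torus s * torus t := by
  simp [torus]

theorem torus_one : (torus 1 : GL (Fin n) F) = 1 := by
  simp [torus]

theorem coe_rootElement {i j : Fin n} (hij : i ≠ j) (c : F) :
    (rootElement hij c : Matrix (Fin n) (Fin n) F) = 1 + Matrix.single i j c := rfl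

theorem rootElement_zero {i j : Fin n} (hij : i ≠ j) :
    (rootElement hij (0 : F) : GL (Fin n) F) = 1 :=
  Units.ext (by simp [coe_rootElement])

theorem torus_mul_rootElement {i j : Fin n} (hij : i ≠ j) (t : Fin n → Fˣ) (c : F) :
    torus t * rootElement hij c = rootElement hij (t i * c * (t j)⁻¹) * torus t := by
  refine Units.ext ?_
  simp only [Units.val_mul, coe_torus, coe_rootElement, mul_add, add_mul, mul_one, one_mul]
  congr 1
  ext x y
  rw [Matrix.diagonal_mul, Matrix.mul_diagonal]
  by_cases hx : i = x
  · by_cases hy : j = y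
    · subst hx hy
      simp
    · simp [hy]
  · simp [hx]

theorem rootElement_mul_rootElement {i j : Fin n} (hij : i ≠ j) (a b : F) (u : Fˣ)
    (hu : (u : F) = 1 + a * b) :
    rootElement hij a * rootElement hij.symm b =
      rootElement hij.symm (b * (u : F)⁻¹) *
        (torus (Pi.mulSingle i u * Pi.mulSingle j u⁻¹) * rootElement hij (a * (u : F)⁻¹)) := by
  have hu0 : (u : F) ≠ 0 := u.ne_zero
  have hT : (torus (Pi.mulSingle i u * Pi.mulSingle j u⁻¹) : Matrix (Fin n) (Fin n) F) =
      1 + Matrix.single i i ((u : F) - 1) + Matrix.single j j ((u : F)⁻¹ - 1) := by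
    rw [coe_torus]
    ext x y
    by_cases hxy : x = y
    · subst hxy
      by_cases hi : x = i
      · subst hi
        simp [hij, hij.symm]
      · by_cases hj : x = j
        · subst hj
          simp [hij]
        · simp [hi, hj, Ne.symm hi, Ne.symm hj]
    · have h1 : ¬ (i = x ∧ i = y) := fun h => hxy (h.1.symm.trans h.2)
      have h2 : ¬ (j = x ∧ j = y) := fun h => hxy (h.1.symm.trans h.2)
      simp [hxy, h1, h2]
  have hab : 1 + a * b ≠ 0 := hu ▸ hu0
  have hba : 1 + b * a ≠ 0 := mul_comm a b ▸ hab
  refine Units.ext ?_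
  simp only [Units.val_mul, coe_rootElement, hT, mul_add, add_mul, mul_one, one_mul,
    Matrix.single_mul_single_same, Matrix.single_mul_single_of_ne _ _ _ _ hij,
    Matrix.single_mul_single_of_ne _ _ _ _ hij.symm, add_zero]
  ext x y
  have key : ∀ z, i ≠ z ∧ j ≠ z ∨ i = z ∨ j = z := fun z => by tauto
  rcases key x with ⟨hxi, hxj⟩ | rfl | rfl <;> rcases key y with ⟨hyi, hyj⟩ | rfl | rfl <;>
    simp [*, hij.symm] <;> field_simp [hab, hba]

end

section

variable {n : ℕ} {F : Type*} [Field F] {V : Type*} [AddCommGroup V] [Module F V]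

theorem IsExpansion.apply_zero [Infinite F] {ρ : Representation F (GL (Fin n) F) V} {i j : Fin n}
    {hij : i ≠ j} {e : ℕ →₀ Module.End F V} (he : IsExpansion ρ hij e) : e 0 = 1 := by
  have h := he 0
  rw [rootElement_zero, map_one, Finsupp.sum, Finset.sum_eq_single 0] at h
  · simpa using h.symm
  · intro r _ hr
    simp [hr]
  · intro h0
    simp [Finsupp.notMem_support_iff.1 h0]

theorem IsExpansion.torus_mul [Infinite F] {ρ : Representation F (GL (Fin n) F) V} {i j : Fin n}
    {hij : i ≠ j} {e : ℕ →₀ Module.End F V} (he : IsExpansion ρ hij e) (t : Fin n → Fˣ) (r : ℕ) :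
    ρ (torus t) * e r = ((t i : F) * (t j : F)⁻¹) ^ r • (e r * ρ (torus t)) := by
  classical
  have hi : (t i : F) ≠ 0 := (t i).ne_zero
  have hj : (t j : F) ≠ 0 := (t j).ne_zero
  let e' : ℕ →₀ Module.End F V := Finsupp.onFinset e.support
    (fun r => ((t j : F) * (t i : F)⁻¹) ^ r • (ρ (torus t) * e r * ρ (torus t⁻¹))) (by
      intro r hr
      rw [Finsupp.mem_support_iff]
      rintro h
      simp [h] at hr)
  have he' : IsExpansion ρ hij e' := by
    intro c
    rw [Finsupp.onFinset_sum _ (by simp)]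
    have h1 : rootElement hij c =
        torus t * rootElement hij (c * ((t j : F) * (t i : F)⁻¹)) * torus t⁻¹ := by
      rw [torus_mul_rootElement, mul_assoc, ← GLRep.torus_mul, mul_inv_cancel, torus_one, mul_one]
      congr 1
      rw [Units.val_inv_eq_inv_val]
      field_simp
    rw [h1, map_mul, map_mul, he, Finsupp.sum, Finset.mul_sum, Finset.sum_mul]
    refine Finset.sum_congr rfl fun r _ => ?_
    rw [mul_smul_comm, smul_mul_assoc, smul_smul, mul_pow]
  have h : e r = ((t j : F) * (t i : F)⁻¹) ^ r • (ρ (torus t) * e r * ρ (torus t⁻¹)) :=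
    DFunLike.congr_fun (isExpansion_unique ρ hij he he') r
  have h2 : e r * ρ (torus t) = ((t j : F) * (t i : F)⁻¹) ^ r • (ρ (torus t) * e r) := by
    conv_lhs => rw [h]
    rw [smul_mul_assoc, mul_assoc _ (ρ (torus t⁻¹)), ← map_mul, ← GLRep.torus_mul, inv_mul_cancel,
      torus_one, map_one, mul_one]
  rw [h2, smul_smul, ← mul_pow]
  have : (t i : F) * (t j : F)⁻¹ * ((t j : F) * (t i : F)⁻¹) = 1 := by field_simp
  rw [this, one_pow, one_smul]

theorem IsExpansion.apply_mem_weightSpace [Infinite F] {ρ : Representation F (GL (Fin n) F) V}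
    {i j : Fin n} {hij : i ≠ j} {e : ℕ →₀ Module.End F V} (he : IsExpansion ρ hij e)
    {μ : Fin n → ℤ} {v : V} (hv : v ∈ weightSpace ρ μ) (r : ℕ) :
    e r v ∈ weightSpace ρ (μ + (Pi.single i (r : ℤ) + Pi.single j (-(r : ℤ)))) := by
  rw [mem_weightSpace] at hv ⊢
  intro t
  have h := LinearMap.congr_fun (he.torus_mul t r) v
  simp only [Module.End.mul_apply, LinearMap.smul_apply, hv t, map_smul, smul_smul] at h
  rw [h, character_add, character_add, character_single, character_single]
  congr 1
  push_cast
  simp [mul_pow, mul_comm]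

/-- If all `c ^ r`-coefficients (`r ≥ 1`) of `ρ (1 + c y_{ij})` kill a vector `v` of weight `μ`,
then `E_{ij} F_{ij} v = (μ_i - μ_j) v`. -/
theorem IsExpansion.apply_one_apply_one [Infinite F] {ρ : Representation F (GL (Fin n) F) V}
    {i j : Fin n} {hij : i ≠ j} {e f : ℕ →₀ Module.End F V} (he : IsExpansion ρ hij e)
    (hf : IsExpansion ρ hij.symm f) {μ : Fin n → ℤ} {d : ℕ} (hd : μ i - μ j = d) {v : V}
    (hv : v ∈ weightSpace ρ μ) (hev : ∀ r, r ≠ 0 → e r v = 0) :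
    e 1 (f 1 v) = (d : F) • v := by
  classical
  have hfix : ∀ c, ρ (rootElement hij c) v = v := by
    intro c
    rw [he c, Finsupp.sum, LinearMap.sum_apply, Finset.sum_eq_single 0]
    · simp [he.apply_zero]
    · intro r _ hr
      simp [hev r hr]
    · intro h0
      simp [Finsupp.notMem_support_iff.1 h0]
  refine sub_eq_zero.1 ((Module.forall_dual_apply_eq_zero_iff F _).1 fun φ => ?_)
  set N := f.support.sup id
  have hle : ∀ s ∈ f.support, s ≤ N := fun s hs => Finset.le_sup (f := id) hs
  have hlow : ∀ b, ρ (rootElement hij.symm b) v = ∑ s ∈ f.support, b ^ s • f s v := by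
    intro b
    rw [hf b]
    simp [Finsupp.sum]
  have hmain : ∀ a b : F, 1 + a * b ≠ 0 →
      (1 + a * b) ^ N * φ (ρ (rootElement hij a) (ρ (rootElement hij.symm b) v)) =
        ∑ s ∈ f.support, b ^ s * φ (f s v) * (1 + a * b) ^ (N + d - s) := by
    intro a b hab
    have h1 := rootElement_mul_rootElement hij a b (Units.mk0 _ hab) rfl
    rw [← Module.End.mul_apply, ← map_mul, h1, map_mul, map_mul, Module.End.mul_apply,
      Module.End.mul_apply, hfix, (mem_weightSpace ρ μ v).1 hv, character_mul,
      character_mulSingle, character_mulSingle, _root_.inv_zpow, ← _root_.zpow_neg, ← _root_.zpow_add, ← sub_eq_add_neg,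
      hd, map_smul, map_smul, hlow]
    simp only [zpow_natCast, Units.val_pow_eq_pow_val, Units.val_mk0, map_sum, map_smul,
      smul_eq_mul, Finset.mul_sum]
    refine Finset.sum_congr rfl fun s hs => ?_
    have h2 : N + d = (N + d - s) + s := by have := hle s hs; omega
    have h3 : (1 + a * b) ^ N * (1 + a * b) ^ d = (1 + a * b) ^ (N + d - s) * (1 + a * b) ^ s := by
      rw [← pow_add, ← pow_add, ← h2]
    rw [← mul_assoc, h3, mul_pow, inv_pow]
    field_simp
  have hstep : ∀ b : F, φ (e 1 (ρ (rootElement hij.symm b) v)) +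
      N * b * φ (ρ (rootElement hij.symm b) v) =
        ∑ s ∈ f.support, b ^ s * φ (f s v) * (((N + d - s : ℕ) : F) * b) := by
    intro b
    set w := ρ (rootElement hij.symm b) v
    let P : Polynomial F := (1 + Polynomial.X * Polynomial.C b) ^ N *
      ∑ r ∈ insert 0 (insert 1 e.support), Polynomial.C (φ (e r w)) * Polynomial.X ^ r
    let Q : Polynomial F := ∑ s ∈ f.support,
      Polynomial.C (b ^ s * φ (f s v)) * (1 + Polynomial.X * Polynomial.C b) ^ (N + d - s)
    have hinf : {a : F | 1 + a * b ≠ 0}.Infinite := by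
      refine Set.Finite.infinite_compl (s := {a : F | 1 + a * b = 0}) ?_
      refine Set.Subsingleton.finite ?_
      intro x (hx : 1 + x * b = 0) y (hy : 1 + y * b = 0)
      have hb : b ≠ 0 := by
        rintro rfl
        simp at hx
      exact mul_right_cancel₀ hb (by linear_combination hx - hy)
    have hPQ : P = Q := by
      refine Polynomial.eq_of_infinite_eval_eq _ _ (hinf.mono fun a ha => ?_)
      have h1 := hmain a b ha
      change P.eval a = Q.eval a
      simp only [P, Q, Polynomial.eval_mul, Polynomial.eval_pow,
        Polynomial.eval_add, Polynomial.eval_one, Polynomial.eval_X, Polynomial.eval_C,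
        Polynomial.eval_finsetSum]
      rw [← h1]
      congr 1
      rw [he a, Finsupp.sum_of_support_subset e (s := insert 0 (insert 1 e.support)) (by
        intro x hx; simp [Finsupp.mem_support_iff.1 hx]) _ (by simp)]
      simp only [LinearMap.sum_apply, LinearMap.smul_apply, map_sum, map_smul, smul_eq_mul,
        mul_comm]
      rfl
    have h0 : ∑ r ∈ insert 0 (insert 1 e.support), φ (e r w) * 0 ^ r = φ w := by
      rw [Finset.sum_eq_single 0]
      · simp [he.apply_zero]
      · intro r _ hr
        simp [hr]
      · simp
    have h1 : ∑ r ∈ insert 0 (insert 1 e.support), φ (e r w) * (r * 0 ^ (r - 1)) =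
        φ (e 1 w) := by
      rw [Finset.sum_eq_single 1]
      · simp
      · intro r _ hr
        rcases r with _ | _ | r
        · simp
        · exact absurd rfl hr
        · simp
      · simp
    have hder := congrArg (fun R => (Polynomial.derivative R).eval 0) hPQ
    simp only [P, Q, Polynomial.derivative_mul, Polynomial.derivative_pow,
      Polynomial.derivative_add, Polynomial.derivative_one, Polynomial.derivative_X,
      Polynomial.derivative_C, Polynomial.derivative_sum, Polynomial.eval_add, Polynomial.eval_mul,
      Polynomial.eval_pow, Polynomial.eval_finsetSum, Polynomial.eval_C, Polynomial.eval_X,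
      Polynomial.eval_one, zero_mul, mul_zero, add_zero, zero_add, one_pow,
      mul_one, one_mul, h0, h1] at hder
    rw [← hder]
    ring
  let P : Polynomial F := ∑ s ∈ insert 0 (insert 1 f.support),
    (Polynomial.C (φ (e 1 (f s v))) * Polynomial.X ^ s +
      Polynomial.C (N * φ (f s v)) * Polynomial.X ^ (s + 1))
  let Q : Polynomial F := ∑ s ∈ insert 0 (insert 1 f.support),
    Polynomial.C (((N + d - s : ℕ) : F) * φ (f s v)) * Polynomial.X ^ (s + 1)
  have hsub : f.support ⊆ insert 0 (insert 1 f.support) := by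
    intro x hx
    simp [Finsupp.mem_support_iff.1 hx]
  have hPQ : P = Q := by
    refine Polynomial.funext fun b => ?_
    have h1 := hstep b
    have hz : ∀ s ∈ insert 0 (insert 1 f.support), s ∉ f.support → f s = 0 :=
      fun s _ hs => Finsupp.notMem_support_iff.1 hs
    simp only [P, Q, Polynomial.eval_finsetSum, Polynomial.eval_add, Polynomial.eval_mul,
      Polynomial.eval_pow, Polynomial.eval_C, Polynomial.eval_X]
    rw [← Finset.sum_subset hsub (fun s h hs => by simp [hz s h hs]),
      ← Finset.sum_subset hsub (fun s h hs => by simp [hz s h hs])]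
    rw [hlow] at h1
    simp only [map_sum, map_smul, smul_eq_mul, Finset.mul_sum, ← Finset.sum_add_distrib] at h1
    refine Eq.trans (Finset.sum_congr rfl fun s _ => ?_) (h1.trans
      (Finset.sum_congr rfl fun s _ => ?_)) <;> ring
  have hc := congrArg (fun R => Polynomial.coeff R 1) hPQ
  simp only [P, Q, Polynomial.finsetSum_coeff, Polynomial.coeff_add, Polynomial.coeff_C_mul_X_pow,
    Finset.sum_add_distrib] at hc
  simp [hf.apply_zero] at hc
  rw [map_sub, map_smul, smul_eq_mul]
  linear_combination hc

end

section

variable {m : ℕ} {F : Type*} [Field F] {V : Type*} [AddCommGroup V] [Module F V]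

theorem levi_torus (s : Fin m → Fˣ) :
    levi m F (torus s) = torus (Fin.append s (1 : Fin 2 → Fˣ)) := by
  refine Units.ext ?_
  rw [coe_torus]
  change Matrix.reindex finSumFinEquiv finSumFinEquiv
    (Matrix.fromBlocks (torus s : Matrix (Fin m) (Fin m) F) 0 0 (1 : Matrix (Fin 2) (Fin 2) F)) = _
  rw [coe_torus, ← Matrix.diagonal_one, Matrix.fromBlocks_diagonal]
  ext x y
  simp only [Matrix.reindex_apply, Matrix.submatrix_apply, Matrix.diagonal_apply,
    EmbeddingLike.apply_eq_iff_eq]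
  split_ifs with h
  · refine Fin.addCases (fun k => ?_) (fun k => ?_) x <;> simp
  · rfl

theorem eq_append_mul_mulSingle (t : Fin (m + 2) → Fˣ) :
    t = Fin.append (fun i => t (Fin.castAdd 2 i)) (1 : Fin 2 → Fˣ) *
      (Pi.mulSingle (idxN1 m) (t (idxN1 m)) * Pi.mulSingle (idxN m) (t (idxN m))) := by
  funext x
  have e0 : idxN1 m = Fin.natAdd m (0 : Fin 2) := by ext; simp [idxN1]
  have e1 : idxN m = Fin.natAdd m (1 : Fin 2) := by ext; simp [idxN]
  have hne : ∀ (k : Fin m) (l : Fin 2), Fin.castAdd 2 k ≠ Fin.natAdd m l := by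
    intro k l h
    have := congrArg Fin.val h
    simp at this
    omega
  rw [e0, e1]
  refine Fin.addCases (fun k => ?_) (fun k => ?_) x
  · simp [Pi.mulSingle_eq_of_ne (hne k _)]
  · fin_cases k <;> simp

theorem character_append_one (μ : Fin (m + 2) → ℤ) (s : Fin m → Fˣ) :
    character μ (Fin.append s (1 : Fin 2 → Fˣ)) = character (dropTwo μ) s := by
  simp only [character, dropTwo]
  rw [Fin.prod_univ_add]
  simp

theorem torus_apply_of_mem_level {ρ : Representation F (GL (Fin (m + 2)) F) V}
    {ν : Fin (m + 2) → ℤ} {i j : ℤ} {v : V} (hv : v ∈ level ρ ν i j) (x y : Fˣ) :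
    ρ (torus (Pi.mulSingle (idxN1 m) x * Pi.mulSingle (idxN m) y)) v =
      ((x ^ (ν (idxN1 m) + i) * y ^ (ν (idxN m) + j) : Fˣ) : F) • v := by
  set T := ρ (torus (Pi.mulSingle (idxN1 m) x * Pi.mulSingle (idxN m) y))
  set c : F := ((x ^ (ν (idxN1 m) + i) * y ^ (ν (idxN m) + j) : Fˣ) : F)
  have h : level ρ ν i j ≤ LinearMap.ker (T - c • LinearMap.id) := by
    refine iSup₂_le fun μ hμ w hw => ?_
    rw [LinearMap.mem_ker, LinearMap.sub_apply, (mem_weightSpace ρ μ w).1 hw, character_mul,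
      character_mulSingle, character_mulSingle, hμ.1, hμ.2]
    simp [c]
  simpa [sub_eq_zero] using h hv

theorem zpow_injective_of_infinite [Infinite F] {a b : ℤ} (h : ∀ x : Fˣ, x ^ a = x ^ b) :
    a = b := by
  by_contra hab
  have h1 : ∀ x : Fˣ, x ^ (a - b).natAbs = 1 := by
    intro x
    have h2 : x ^ (a - b) = 1 := by rw [_root_.zpow_sub, h x, mul_inv_cancel]
    rcases Int.natAbs_eq (a - b) with h3 | h3
    · rw [h3] at h2
      exact_mod_cast h2
    · rw [h3, _root_.zpow_neg, inv_eq_one] at h2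
      exact_mod_cast h2
  have hk : (a - b).natAbs ≠ 0 := by omega
  have hX : (Polynomial.X ^ (a - b).natAbs - 1 : Polynomial F) = 0 := by
    refine Polynomial.eq_zero_of_infinite_isRoot _ (Set.Infinite.mono (s := {0}ᶜ) ?_
      (Set.finite_singleton (0 : F)).infinite_compl)
    intro x hx
    have h4 : x ^ (a - b).natAbs = 1 := congrArg Units.val (h1 (Units.mk0 x hx))
    simp [Polynomial.IsRoot, h4]
  exact (Polynomial.monic_X_pow_sub_C (1 : F) hk).ne_zero (by simpa using hX)

theorem apply_eq_of_weightSpace_le_level [Infinite F]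
    {ρ : Representation F (GL (Fin (m + 2)) F) V} {ν μ : Fin (m + 2) → ℤ} {i j : ℤ}
    (hμ : weightSpace ρ μ ≠ ⊥) (hle : weightSpace ρ μ ≤ level ρ ν i j) :
    μ (idxN1 m) = ν (idxN1 m) + i ∧ μ (idxN m) = ν (idxN m) + j := by
  obtain ⟨v, hv, hv0⟩ := (Submodule.ne_bot_iff _).1 hμ
  have key : ∀ x y : Fˣ, x ^ μ (idxN1 m) * y ^ μ (idxN m) =
      x ^ (ν (idxN1 m) + i) * y ^ (ν (idxN m) + j) := by
    intro x y
    have h := torus_apply_of_mem_level (hle hv) x y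
    rw [(mem_weightSpace ρ μ v).1 hv, character_mul, character_mulSingle,
      character_mulSingle] at h
    exact Units.ext (smul_left_injective F hv0 h)
  exact ⟨zpow_injective_of_infinite fun x => by simpa using key x 1,
    zpow_injective_of_infinite fun y => by simpa using key 1 y⟩

theorem leviWeightSpace_levelTimes (ρ : Representation F (GL (Fin (m + 2)) F) V)
    {ν μ : Fin (m + 2) → ℤ} {i j : ℤ} (hi : μ (idxN1 m) = ν (idxN1 m) + i)
    (hj : μ (idxN m) = ν (idxN m) + j) :
    leviWeightSpace ρ (levelTimes ρ ν i j) (dropTwo μ) =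
      weightSpace ρ μ ⊓ LinearMap.ker (raising ρ) := by
  ext v
  simp only [leviWeightSpace, levelTimes, Submodule.mem_inf]
  constructor
  · rintro ⟨⟨hl, hk⟩, hw⟩
    refine ⟨(mem_weightSpace ρ μ v).2 fun t => ?_, hk⟩
    rw [eq_append_mul_mulSingle t, torus_mul, map_mul, Module.End.mul_apply,
      torus_apply_of_mem_level hl, map_smul, ← levi_torus]
    have h := (mem_weightSpace _ _ _).1 hw (fun i => t (Fin.castAdd 2 i))
    rw [MonoidHom.comp_apply] at h
    rw [h, smul_smul, character_mul, character_mul, character_mulSingle, character_mulSingle,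
      character_append_one, hi, hj]
    push_cast
    rw [mul_comm]
  · rintro ⟨hw, hk⟩
    refine ⟨⟨Submodule.mem_iSup_of_mem μ (Submodule.mem_iSup_of_mem ⟨hi, hj⟩ hw), hk⟩, ?_⟩
    refine (mem_weightSpace _ _ _).2 fun s => ?_
    rw [MonoidHom.comp_apply, levi_torus, (mem_weightSpace ρ μ v).1 hw, character_append_one]

theorem Subdominant.last_le {k : ℕ} {μ ν : Fin (k + 2) → ℤ} (h : Subdominant μ ν) :
    ν (Fin.last (k + 1)) ≤ μ (Fin.last (k + 1)) := by
  obtain ⟨a, ha⟩ := h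
  have h1 := congrFun ha (Fin.last (k + 1))
  rw [Finset.sum_apply] at h1
  have h2 : ∑ i, ((a i : ℤ) • simpleRoot i) (Fin.last (k + 1)) ≤ 0 := by
    refine Finset.sum_nonpos fun i _ => ?_
    have h3 : simpleRoot i (Fin.last (k + 1)) ≤ 0 := by
      rw [simpleRoot, Pi.sub_apply, Pi.single_eq_of_ne (Fin.castSucc_lt_last i).ne', zero_sub,
        neg_nonpos, Pi.single_apply]
      split_ifs <;> simp
    rw [Pi.smul_apply, smul_eq_mul]
    exact mul_nonpos_of_nonneg_of_nonpos (Int.natCast_nonneg _) h3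
  rw [Pi.sub_apply] at h1
  omega

end

end GLRep

theorem theorem4
    {F : Type*} [Field F] [IsAlgClosed F] (p : ℕ) [Fact p.Prime] [CharP F p] (hp : p ≠ 2)
    (m : ℕ) (ν : Fin (m + 2) → ℤ) (hdom : Antitone ν)
    (hν : ν (GLRep.idxN1 m) = 0) (hν' : ν (GLRep.idxN m) = 0)
    {V : Type*} [AddCommGroup V] [Module F V]
    (L : Representation F (Matrix.GeneralLinearGroup (Fin (m + 2)) F) V)
    (hL : GLRep.IsSimpleOfHighestWeight L ν)
    (μ : Fin (m + 2) → ℤ) (hμ : GLRep.weightSpace L μ ≠ ⊥)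
    (hlevel : GLRep.weightSpace L μ ≤ GLRep.level L ν 1 1) :
    (Module.finrank F
        (GLRep.leviWeightSpace L (GLRep.levelTimes L ν 1 1) (GLRep.dropTwo μ)) : ℤ) =
      (Module.finrank F (GLRep.weightSpace L μ) : ℤ) -
        (Module.finrank F (GLRep.weightSpace L (GLRep.omegaWeight μ)) : ℤ) ∧
    (GLRep.weightSpace L μ).map (GLRep.raising L) =
      GLRep.weightSpace L (GLRep.omegaWeight μ) := by
  classical
  have hinf : Infinite F := IsAlgClosed.instInfinite
  have := hL.rational.finiteDimensional
  have h2 : ((2 : ℕ) : F) ≠ 0 := by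
    intro h
    have h' := (CharP.cast_eq_zero_iff F p 2).1 h
    exact hp ((Nat.prime_dvd_prime_iff_eq Fact.out Nat.prime_two).1 h')
  obtain ⟨h1, h1'⟩ := GLRep.apply_eq_of_weightSpace_le_level hμ hlevel
  have hne := GLRep.idxN1_ne_idxN m
  obtain ⟨e, he⟩ := GLRep.exists_isExpansion L hL.rational hne
  obtain ⟨f, hf⟩ := GLRep.exists_isExpansion L hL.rational hne.symm
  have hE : GLRep.raising L = e 1 := GLRep.dividedPower_eq L hne he 1
  have hω1 : GLRep.omegaWeight μ (GLRep.idxN1 m) = 2 := by simp [GLRep.omegaWeight, hne]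
  have hω2 : GLRep.omegaWeight μ (GLRep.idxN m) = 0 := by simp [GLRep.omegaWeight]
  have hω : μ + (Pi.single (GLRep.idxN1 m) ((1 : ℕ) : ℤ) +
      Pi.single (GLRep.idxN m) (-((1 : ℕ) : ℤ))) = GLRep.omegaWeight μ := by
    funext x
    by_cases hx : x = GLRep.idxN m
    · subst hx
      simp [hω2, hne.symm, h1', hν']
    · by_cases hx' : x = GLRep.idxN1 m
      · subst hx'
        simp [hω1, hne, h1, hν]
      · simp [GLRep.omegaWeight, hx, hx']
  have hμω : GLRep.omegaWeight μ + (Pi.single (GLRep.idxN m) ((1 : ℕ) : ℤ) +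
      Pi.single (GLRep.idxN1 m) (-((1 : ℕ) : ℤ))) = μ := by
    rw [← hω]
    push_cast
    rw [Pi.single_neg, Pi.single_neg]
    abel
  have hsurj : (GLRep.weightSpace L μ).map (GLRep.raising L) =
      GLRep.weightSpace L (GLRep.omegaWeight μ) := by
    rw [hE]
    apply le_antisymm
    · rintro _ ⟨v, hv, rfl⟩
      exact hω ▸ he.apply_mem_weightSpace hv 1
    · intro v hv
      have hkill : ∀ r, r ≠ 0 → e r v = 0 := by
        intro r hr
        by_contra h0
        have hw := he.apply_mem_weightSpace hv r
        have hlast := (hL.highest _ ((Submodule.ne_bot_iff _).2 ⟨_, hw, h0⟩)).last_le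
        change ν (GLRep.idxN m) ≤ (_ : Fin (m + 2) → ℤ) (GLRep.idxN m) at hlast
        simp [hν', hω2, hne.symm] at hlast
        omega
      have hEF : e 1 (f 1 v) = ((2 : ℕ) : F) • v :=
        he.apply_one_apply_one hf (by rw [hω1, hω2]; rfl) hv hkill
      have hfv : f 1 v ∈ GLRep.weightSpace L μ := by
        have h := hf.apply_mem_weightSpace hv 1
        rwa [hμω] at h
      refine ⟨((2 : ℕ) : F)⁻¹ • f 1 v, Submodule.smul_mem _ _ hfv, ?_⟩
      rw [map_smul, hEF, smul_smul, inv_mul_cancel₀ h2, one_smul]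
  refine ⟨?_, hsurj⟩
  rw [GLRep.leviWeightSpace_levelTimes L h1 h1', ← hsurj]
  have hrn := LinearMap.finrank_range_add_finrank_ker
    ((GLRep.raising L).domRestrict (GLRep.weightSpace L μ))
  rw [LinearMap.range_domRestrict, LinearMap.ker_domRestrict] at hrn
  have hk : Module.finrank F
      ((GLRep.weightSpace L μ ⊓ LinearMap.ker (GLRep.raising L) : Submodule F V)) =
      Module.finrank F ((LinearMap.ker (GLRep.raising L)).comap
        (GLRep.weightSpace L μ).subtype) := by
    rw [← Submodule.map_comap_subtype]
    exact Submodule.finrank_map_subtype_eq _ _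
  rw [hk]
  omega
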